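/- Let $A, A_d\in\mathbb{R}^{n\times n}$, $B\in\mathbb{R}^{n\times m}$, $B_d\in\mathbb{R}^{n\times p}$, and consider, for a constant delay $h\ge 0$, the time delay system $$\dot x(t)=Ax(t)+A_dx(t-h)+Bu(t-h)+B_dd(t)\quad(t\ge 0),\qquad x(\theta)=\phi(\theta)\quad(\theta\in[-h,0]),$$ with input $u$, disturbance $d$ and continuous initial condition $\phi$. Suppose there are symmetric positive definite matrices $P,R\in\mathbb{R}^{n\times n}$ and $Q\in\mathbb{R}^{rn\times rn}$, a matrix $X\in\mathbb{R}^{(r+2)n\times n}$, a scalar $h_m>0$, an integer $r\ge 1$ and a matrix $K\in\mathbb{R}^{m\times n}$ such that $$\Gamma+XS+S^TX^T<0 ,\qquad S=\begin{bmatrix}-1 & A & 0_{n\times(r-1)n} & A_d+BK\end{bmatrix},$$ where $\Gamma=\Gamma_0+\Gamma_1-\Gamma_2$ is the symmetric $(r+2)n\times(r+2)n$ matrix whose summands, in $n\times n$ blocks, are as follows. The upper left $3\times 3$ blocks of $\Gamma_0$ are $$\begin{bmatrix}\frac{h_m}{r}R & P & 0\\ P & -\frac{r}{h_m}R & \frac{r}{h_m}R\\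 0 & \frac{r}{h_m}R & -\frac{r}{h_m}R\end{bmatrix},$$ and all its other blocks are $0$; $\Gamma_1$ has $Q$ in block rows and columns $2,\dots,r+1$ and zeros elsewhere; $\Gamma_2$ has $Q$ in block rows and columns $3,\dots,r+2$ and zeros elsewhere. Then for every $h$ with $0\le h\le h_m$ the control law $u(t)=Kx(t)$ stabilizes the system with $d=0$: the zero solution of the closed loop $\dot x(t)=Ax(t)+(A_d+BK)x(t-h)$ is globally uniformly asymptotically stable. That is, for every $\varepsilon>0$ there is $\delta>0$ such that $\sup_{[-h,0]}\|\phi\|\le\delta$ implies $\|x(t)\|<\varepsilon$ for all $t\ge 0$, and for all $\rho,\varepsilon>0$ there is $T>0$ such that $\sup_{[-h,0]}\|\phi\|\le\rho$ implies $\|x(t)\|<\varepsilon$ for all $t\ge T$. -/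

import Mathlib

open Set

namespace TimeDelay

/-- `x` is a (classical) solution of the linear time delay system
`x'(t) = A x(t) + Ad x(t - h) + B u(t - h) + Bd d(t)` for `t ≥ 0`, with initial condition
`x(θ) = φ(θ)` for `θ ∈ [-h, 0]`; `u` is the input and `d` the disturbance. The derivative is
one-sided at `t = 0` and two-sided at every `t > 0`. -/
def IsSolution {n m p : ℕ} (A Ad : Matrix (Fin n) (Fin n) ℝ) (B : Matrix (Fin n) (Fin m) ℝ)
    (Bd : Matrix (Fin n) (Fin p) ℝ) (h : ℝ) (φ : ℝ → Fin n → ℝ)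
    (u : ℝ → Fin m → ℝ) (d : ℝ → Fin p → ℝ) (x : ℝ → Fin n → ℝ) : Prop :=
  ContinuousOn x (Ici (-h)) ∧
  (∀ θ ∈ Icc (-h) 0, x θ = φ θ) ∧
  ∀ t, 0 ≤ t → HasDerivWithinAt x
    (A.mulVec (x t) + Ad.mulVec (x (t - h)) + B.mulVec (u (t - h)) + Bd.mulVec (d t)) (Ici 0) t

/-- `x` solves, with initial condition `φ`, the system above in closed loop with the state
feedback `u(t) = K x(t)` (which enters through the delayed input), with zero disturbance. -/
def IsClosedLoopSolution {n m p : ℕ} (A Ad : Matrix (Fin n) (Fin n) ℝ)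
    (B : Matrix (Fin n) (Fin m) ℝ) (Bd : Matrix (Fin n) (Fin p) ℝ) (K : Matrix (Fin m) (Fin n) ℝ)
    (h : ℝ) (φ x : ℝ → Fin n → ℝ) : Prop :=
  IsSolution A Ad B Bd h φ (fun t => K.mulVec (x t)) (fun _ => 0) x

/-- Global uniform asymptotic stability of the zero solution of a (time-invariant) system with
delay `h` on `ℝⁿ`, where `Sol φ x` says that `x` is a solution with initial condition `φ`.
Initial conditions are measured in the supremum norm over `[-h, 0]`. The norm of `Fin n → ℝ` is
used on `ℝⁿ`; as all norms on `ℝⁿ` are equivalent, the notion does not depend on it. -/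
def IsStable {n : ℕ} (h : ℝ) (Sol : (ℝ → Fin n → ℝ) → (ℝ → Fin n → ℝ) → Prop) : Prop :=
  (∀ ε > 0, ∃ δ > 0, ∀ φ x : ℝ → Fin n → ℝ, Sol φ x →
    (∀ θ ∈ Icc (-h) 0, ‖φ θ‖ ≤ δ) → ∀ t, 0 ≤ t → ‖x t‖ < ε) ∧
  (∀ ρ > 0, ∀ ε > 0, ∃ T > 0, ∀ φ x : ℝ → Fin n → ℝ, Sol φ x →
    (∀ θ ∈ Icc (-h) 0, ‖φ θ‖ ≤ ρ) → ∀ t, T ≤ t → ‖x t‖ < ε)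

/-- Row and column indices of `(r+2)n × (r+2)n` matrices: `r + 2` blocks, numbered from `0`,
of size `n`. Block `0` stands for `x'(t)` and block `k + 1` for `x(t - (k/r) h)`,
`k = 0, …, r`. -/
abbrev BlockIdx (r n : ℕ) : Type := Fin (r + 2) × Fin n

/-- The `n × n` blocks of the part of `Γ` that involves `P` and `R`:
rows `[(hm/r) R, P, 0, …]`, `[P, -(r/hm) R, (r/hm) R, 0, …]`, `[0, (r/hm) R, -(r/hm) R, 0, …]`,
all other blocks being zero. -/
noncomputable def gammaBlock {n : ℕ} (r : ℕ) (hm : ℝ) (P R : Matrix (Fin n) (Fin n) ℝ) :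
    ℕ → ℕ → Matrix (Fin n) (Fin n) ℝ
  | 0, 0 => (hm / r) • R
  | 0, 1 => P
  | 1, 0 => P
  | 1, 1 => -((r / hm) • R)
  | 1, 2 => (r / hm) • R
  | 2, 1 => (r / hm) • R
  | 2, 2 => -((r / hm) • R)
  | _, _ => 0

/-- The part of `Γ` that involves `P` and `R`. -/
noncomputable def gammaPR {n : ℕ} (r : ℕ) (hm : ℝ) (P R : Matrix (Fin n) (Fin n) ℝ) :
    Matrix (BlockIdx r n) (BlockIdx r n) ℝ :=
  Matrix.of fun i j => gammaBlock r hm P R i.1 j.1 i.2 j.2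

/-- The `(r+2)n × (r+2)n` matrix with the `rn × rn` matrix `Q` in block rows and block columns
`s, …, s + r - 1` and zeros elsewhere. -/
def embedQ {n : ℕ} (r s : ℕ) (Q : Matrix (Fin r × Fin n) (Fin r × Fin n) ℝ) :
    Matrix (BlockIdx r n) (BlockIdx r n) ℝ :=
  Matrix.of fun i j =>
    if hij : (s ≤ (i.1 : ℕ) ∧ (i.1 : ℕ) - s < r) ∧ (s ≤ (j.1 : ℕ) ∧ (j.1 : ℕ) - s < r) then
      Q (⟨(i.1 : ℕ) - s, hij.1.2⟩, i.2) (⟨(j.1 : ℕ) - s, hij.2.2⟩, j.2)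
    else 0

/-- The matrix `Γ`: `P`, `R` part, plus `Q` in the blocks `1, …, r` of
`x(t), …, x(t - ((r-1)/r) h)`, minus `Q` in the blocks `2, …, r + 1` of
`x(t - h/r), …, x(t - h)`. -/
noncomputable def Gam {n : ℕ} (r : ℕ) (hm : ℝ) (P R : Matrix (Fin n) (Fin n) ℝ)
    (Q : Matrix (Fin r × Fin n) (Fin r × Fin n) ℝ) :
    Matrix (BlockIdx r n) (BlockIdx r n) ℝ :=
  gammaPR r hm P R + embedQ r 1 Q - embedQ r 2 Q

/-- The `n × (r+2)n` matrix `S = [-1, A, 0, D]` with `r - 1` zero blocks (for `r ≥ 1`). -/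
def rowS {n : ℕ} (r : ℕ) (A D : Matrix (Fin n) (Fin n) ℝ) : Matrix (Fin n) (BlockIdx r n) ℝ :=
  Matrix.of fun a j =>
    if (j.1 : ℕ) = 0 then (-1 : Matrix (Fin n) (Fin n) ℝ) a j.2
    else if (j.1 : ℕ) = 1 then A a j.2
    else if (j.1 : ℕ) = r + 1 then D a j.2
    else 0

end TimeDelay

/-!
Write `D = Ad + B K`, `τ = h / r`, `f(t) = A x(t) + D x(t - h)` for the right-hand side of the
closed loop, and `ζ(t) = (x(t), x(t - τ), …, x(t - (r - 1) τ))`. The proof rests on the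
Lyapunov–Krasovskii functional

`V(t) = xᵀ P x + ∫ s in (t - τ)..t, (s - (t - τ)) f(s)ᵀ R f(s) + ∫ s in (t - τ)..t, ζ(s)ᵀ Q ζ(s)
  + ε ∫ s in (t - h)..t, (s - (t - h)) w(s)`,   `w = xᵀ x + fᵀ f`.

Its derivative contains `τ fᵀ R f - ∫ s in (t - τ)..t, fᵀ R f`; Jensen's inequality
(`jensen_slide`) bounds the integral below by the increment `x(t) - x(t - τ)`, and `h ≤ hm` allows
`τ` to be replaced by `hm / r`. What results, apart from the `ε` term, is the quadratic form of `Γ`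
at `(x'(t), x(t), x(t - τ), …, x(t - h))`. This vector lies in the kernel of `S`, where the
multiplier terms `X S + Sᵀ Xᵀ` drop out, so the form is at most `-c w(t)` (`exists_lmi_bound`).

The `ε` term has derivative `ε (h w(t) - ∫ s in (t - h)..t, w)`. For small `ε` it gives
`V' ≤ -ε (w + ∫ w)`, while `V ≤ K (w + ∫ w)` by the tiling of `[t - h, t]` into `r` windows of
length `τ`. Hence `V' ≤ -(ε / K) V`, and `V` decays exponentially (`exists_lyapunov_decay`).

As the initial condition is merely continuous, `x(t) - x(t - τ)` is the integral of `f` only if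
`t ≥ τ`; the decay is derived for `t ≥ h`. On `[0, h]` the
functional `xᵀ x + ∫ s in (t - h)..t, xᵀ x` grows at most exponentially (`exists_growth_bound`).
Together the two give `‖x t‖ ^ 2 ≤ C M ^ 2 exp (-μ t)` with `M` the supremum of the initial
condition (`exists_exponential_bound`), from which both halves of stability follow.
-/

namespace TimeDelay
open scoped Matrix

/-! ### Quadratic forms on `ι → ℝ` -/

theorem dotProduct_self_nonneg {ι : Type*} [Fintype ι] (v : ι → ℝ) : 0 ≤ v ⬝ᵥ v :=
  Finset.sum_nonneg fun i _ => mul_self_nonneg (v i)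

theorem sq_le_dotProduct_self {ι : Type*} [Fintype ι] (v : ι → ℝ) (i : ι) :
    v i ^ 2 ≤ v ⬝ᵥ v := by
  rw [sq]
  exact Finset.single_le_sum (f := fun j => v j * v j) (fun j _ => mul_self_nonneg (v j))
    (Finset.mem_univ i)

theorem norm_sq_le_dotProduct_self {ι : Type*} [Fintype ι] (v : ι → ℝ) :
    ‖v‖ ^ 2 ≤ v ⬝ᵥ v := by
  have h : ‖v‖ ≤ √(v ⬝ᵥ v) := by
    refine (pi_norm_le_iff_of_nonneg (Real.sqrt_nonneg _)).2 fun i => ?_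
    exact Real.abs_le_sqrt (sq_le_dotProduct_self v i)
  calc ‖v‖ ^ 2 ≤ √(v ⬝ᵥ v) ^ 2 := by gcongr
    _ = v ⬝ᵥ v := Real.sq_sqrt (dotProduct_self_nonneg v)

theorem dotProduct_self_le_norm_sq {ι : Type*} [Fintype ι] (v : ι → ℝ) :
    v ⬝ᵥ v ≤ Fintype.card ι * ‖v‖ ^ 2 := by
  calc v ⬝ᵥ v ≤ ∑ _i : ι, ‖v‖ ^ 2 := by
        refine Finset.sum_le_sum fun i _ => ?_
        have h : |v i| ≤ ‖v‖ := norm_le_pi_norm v i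
        rw [← sq, ← sq_abs]
        gcongr
    _ = Fintype.card ι * ‖v‖ ^ 2 := by simp

theorem two_mul_dotProduct_le {ι : Type*} [Fintype ι] (u v : ι → ℝ) :
    2 * (u ⬝ᵥ v) ≤ u ⬝ᵥ u + v ⬝ᵥ v := by
  have h := dotProduct_self_nonneg (u - v)
  simp only [sub_dotProduct, dotProduct_sub, dotProduct_comm v u] at h
  linarith

theorem exists_quadForm_le {ι : Type*} [Fintype ι] (M : Matrix ι ι ℝ) :
    ∃ C, 0 ≤ C ∧ ∀ v : ι → ℝ, v ⬝ᵥ M *ᵥ v ≤ C * (v ⬝ᵥ v) := by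
  refine ⟨∑ i, ∑ j, |M i j|, by positivity, fun v => ?_⟩
  have hexp : v ⬝ᵥ M *ᵥ v = ∑ i, ∑ j, v i * (M i j * v j) :=
    Finset.sum_congr rfl fun i _ => Finset.mul_sum _ _ _
  rw [hexp, Finset.sum_mul]
  refine Finset.sum_le_sum fun i _ => ?_
  rw [Finset.sum_mul]
  refine Finset.sum_le_sum fun j _ => ?_
  have hi := sq_le_dotProduct_self v i
  have hj := sq_le_dotProduct_self v j
  have hij : |v i * v j| ≤ v ⬝ᵥ v := by
    rw [abs_le]
    constructor <;> nlinarith [sq_nonneg (v i + v j), sq_nonneg (v i - v j)]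
  calc v i * (M i j * v j) = M i j * (v i * v j) := by ring
    _ ≤ |M i j| * |v i * v j| := by rw [← abs_mul]; exact le_abs_self _
    _ ≤ |M i j| * (v ⬝ᵥ v) := by gcongr

theorem exists_mulVec_dotProduct_le {ι κ : Type*} [Fintype ι] [Fintype κ] (M : Matrix ι κ ℝ) :
    ∃ C, 0 ≤ C ∧ ∀ v : κ → ℝ, M *ᵥ v ⬝ᵥ M *ᵥ v ≤ C * (v ⬝ᵥ v) := by
  obtain ⟨C, hC, h⟩ := exists_quadForm_le (Mᵀ * M)
  refine ⟨C, hC, fun v => (le_of_eq ?_).trans (h v)⟩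
  rw [← Matrix.mulVec_mulVec, Matrix.dotProduct_mulVec v, Matrix.vecMul_transpose]

theorem quadForm_nonneg {ι : Type*} [Fintype ι] {M : Matrix ι ι ℝ} (hM : M.PosDef) (v : ι → ℝ) :
    0 ≤ v ⬝ᵥ M *ᵥ v := by
  simpa using hM.posSemidef.dotProduct_mulVec_nonneg v

/-- The quadratic form of a positive definite matrix attains a positive minimum on the compact
unit sphere; homogeneity extends the bound to all vectors. -/
theorem exists_le_quadForm {ι : Type*} [Fintype ι] {M : Matrix ι ι ℝ} (hM : M.PosDef) :
    ∃ c > 0, ∀ v : ι → ℝ, c * (v ⬝ᵥ v) ≤ v ⬝ᵥ M *ᵥ v := by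
  cases isEmpty_or_nonempty ι with
  | inl hι => exact ⟨1, one_pos, fun v => by simp [dotProduct]⟩
  | inr hι =>
    have hcont : Continuous fun v : ι → ℝ => v ⬝ᵥ M *ᵥ v := by fun_prop
    obtain ⟨u, hu, hmin⟩ := (isCompact_sphere (0 : ι → ℝ) 1).exists_isMinOn
      (NormedSpace.sphere_nonempty.2 zero_le_one) hcont.continuousOn
    have hu0 : u ≠ 0 := by
      rintro rfl
      simp at hu
    have hpos : 0 < u ⬝ᵥ M *ᵥ u := by simpa using hM.dotProduct_mulVec_pos hu0
    have hcard : (0 : ℝ) < Fintype.card ι := by exact_mod_cast Fintype.card_pos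
    refine ⟨(u ⬝ᵥ M *ᵥ u) / Fintype.card ι, by positivity, fun v => ?_⟩
    by_cases hv : v = 0
    · simp [hv]
    have hv' : 0 < ‖v‖ := norm_pos_iff.2 hv
    have h1 : u ⬝ᵥ M *ᵥ u ≤ (‖v‖⁻¹ • v) ⬝ᵥ M *ᵥ (‖v‖⁻¹ • v) :=
      hmin (by simp [norm_smul, hv'.ne'])
    have h2 : (‖v‖⁻¹ • v) ⬝ᵥ M *ᵥ (‖v‖⁻¹ • v) = (v ⬝ᵥ M *ᵥ v) / ‖v‖ ^ 2 := by
      simp only [Matrix.mulVec_smul, smul_dotProduct, dotProduct_smul, smul_eq_mul]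
      field_simp
    rw [h2, le_div_iff₀ (by positivity)] at h1
    calc (u ⬝ᵥ M *ᵥ u) / Fintype.card ι * (v ⬝ᵥ v)
        ≤ (u ⬝ᵥ M *ᵥ u) / Fintype.card ι * (Fintype.card ι * ‖v‖ ^ 2) := by
          gcongr
          exact dotProduct_self_le_norm_sq v
      _ = (u ⬝ᵥ M *ᵥ u) * ‖v‖ ^ 2 := by field_simp
      _ ≤ v ⬝ᵥ M *ᵥ v := h1

theorem quadForm_comm {ι : Type*} [Fintype ι] {M : Matrix ι ι ℝ} (hM : M.PosDef) (u v : ι → ℝ) :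
    u ⬝ᵥ M *ᵥ v = v ⬝ᵥ M *ᵥ u := by
  have hT : Mᵀ = M := by simpa using hM.isHermitian.eq
  rw [Matrix.dotProduct_mulVec, ← Matrix.mulVec_transpose, hT, dotProduct_comm]

/-! ### The matrix inequality along solutions -/

/-- The sequence `a, z 0, z 1, …`. -/
def prepend {n : ℕ} (a : Fin n → ℝ) (z : ℕ → Fin n → ℝ) : ℕ → Fin n → ℝ
  | 0 => a
  | k + 1 => z k

@[simp] theorem prepend_zero {n : ℕ} (a : Fin n → ℝ) (z : ℕ → Fin n → ℝ) :
    prepend a z 0 = a := rfl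

@[simp] theorem prepend_succ {n : ℕ} (a : Fin n → ℝ) (z : ℕ → Fin n → ℝ) (k : ℕ) :
    prepend a z (k + 1) = z k := rfl

/-- The vector `(a, z 0, …, z r)` in block form. In the application `a = x'(t)` and
`z k = x(t - (k/r) h)`. -/
def stack {n : ℕ} (r : ℕ) (a : Fin n → ℝ) (z : ℕ → Fin n → ℝ) : BlockIdx r n → ℝ :=
  fun i => prepend a z i.1 i.2

/-- The vector `(z 0, …, z (r - 1))` in block form. -/
def window {n : ℕ} (r : ℕ) (z : ℕ → Fin n → ℝ) : Fin r × Fin n → ℝ :=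
  fun i => z i.1 i.2

theorem quadForm_embedQ {n : ℕ} (r s : ℕ) (hs : s ≤ 2)
    (Q : Matrix (Fin r × Fin n) (Fin r × Fin n) ℝ) (u : BlockIdx r n → ℝ)
    (v : Fin r × Fin n → ℝ)
    (huv : ∀ i, v i = u (⟨i.1 + s, by have := i.1.2; omega⟩, i.2)) :
    u ⬝ᵥ embedQ r s Q *ᵥ u = v ⬝ᵥ Q *ᵥ v := by
  let e : Fin r × Fin n → BlockIdx r n := fun i => (⟨i.1 + s, by have := i.1.2; omega⟩, i.2)
  have he : Function.Injective e := by
    rintro ⟨⟨i, hi⟩, a⟩ ⟨⟨j, hj⟩, b⟩ hij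
    simp only [e, Prod.mk.injEq, Fin.mk.injEq] at hij ⊢
    exact ⟨by omega, hij.2⟩
  have hout : ∀ i : BlockIdx r n, i ∉ range e → ¬ (s ≤ (i.1 : ℕ) ∧ (i.1 : ℕ) - s < r) := by
    rintro ⟨⟨i, hi⟩, a⟩ hne ⟨h1, h2⟩
    refine hne ⟨(⟨i - s, h2⟩, a), ?_⟩
    simp only [e, Prod.mk.injEq, Fin.mk.injEq, and_true]
    exact Nat.sub_add_cancel h1
  have hmv : ∀ i, (Q *ᵥ v) i = (embedQ r s Q *ᵥ u) (e i) := by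
    intro i
    refine Fintype.sum_of_injective e he _ _ ?_ ?_
    · intro j hj
      simp [embedQ, hout j hj]
    · intro j
      simp [embedQ, e, huv]
  symm
  refine Fintype.sum_of_injective e he _ _ ?_ ?_
  · intro j hj
    have : (embedQ r s Q *ᵥ u) j = 0 :=
      Finset.sum_eq_zero fun k _ => by simp [embedQ, hout j hj]
    simp [this]
  · intro j
    rw [hmv j, huv j]

theorem quadForm_gammaPR {n : ℕ} (r : ℕ) (hr : 1 ≤ r) (hm : ℝ) {P R : Matrix (Fin n) (Fin n) ℝ}
    (hP : P.PosDef) (hR : R.PosDef) (a : Fin n → ℝ) (z : ℕ → Fin n → ℝ) :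
    stack r a z ⬝ᵥ gammaPR r hm P R *ᵥ stack r a z
      = hm / r * (a ⬝ᵥ R *ᵥ a) + 2 * (z 0 ⬝ᵥ P *ᵥ a)
        - r / hm * ((z 0 - z 1) ⬝ᵥ R *ᵥ (z 0 - z 1)) := by
  obtain ⟨q, rfl⟩ : ∃ q, r = q + 1 := ⟨r - 1, by omega⟩
  have key : stack (q + 1) a z ⬝ᵥ gammaPR (q + 1) hm P R *ᵥ stack (q + 1) a z
      = ∑ k : Fin (q + 3), ∑ l : Fin (q + 3),
        prepend a z k ⬝ᵥ
          gammaBlock (q + 1) hm P R k l *ᵥ prepend a z l := by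
    simp only [dotProduct, Matrix.mulVec, stack, gammaPR, Fintype.sum_prod_type, Matrix.of_apply,
      Finset.mul_sum]
    refine Finset.sum_congr rfl fun k _ => ?_
    rw [Finset.sum_comm]
  have hPc := quadForm_comm hP a (z 0)
  have hRc := quadForm_comm hR (z 1) (z 0)
  rw [key]
  simp only [Fin.sum_univ_succ, Fin.val_zero, Fin.val_succ, gammaBlock, prepend_zero,
    prepend_succ, Matrix.zero_mulVec,
    dotProduct_zero, Finset.sum_const_zero, add_zero, zero_add, Matrix.smul_mulVec,
    dotProduct_smul, smul_eq_mul, Matrix.neg_mulVec, dotProduct_neg, Matrix.mulVec_sub,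
    dotProduct_sub, sub_dotProduct, hPc, hRc, Nat.reduceAdd]
  ring

theorem rowS_mulVec_stack {n : ℕ} (r : ℕ) (hr : 1 ≤ r) (A D : Matrix (Fin n) (Fin n) ℝ)
    (a : Fin n → ℝ) (z : ℕ → Fin n → ℝ) :
    rowS r A D *ᵥ stack r a z = -a + A *ᵥ z 0 + D *ᵥ z r := by
  obtain ⟨q, rfl⟩ : ∃ q, r = q + 1 := ⟨r - 1, by omega⟩
  ext b
  simp only [Matrix.mulVec, dotProduct, stack, rowS, Fintype.sum_prod_type, Matrix.of_apply]
  rw [Fin.sum_univ_succ, Fin.sum_univ_succ, Fin.sum_univ_castSucc]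
  have h1 : ∑ l, (-1 : Matrix (Fin n) (Fin n) ℝ) b l * a l = -a b := by
    have := congrFun (Matrix.neg_mulVec a (1 : Matrix (Fin n) (Fin n) ℝ)) b
    rwa [Matrix.one_mulVec] at this
  have h2 : ∀ i : Fin q, ¬ ((i : ℕ) + 1 + 1 = q + 1 + 1) := fun i => by have := i.2; omega
  simp only [Fin.val_zero, Fin.val_succ, Fin.val_castSucc, Fin.val_last, if_true, h1, h2,
    prepend_zero, prepend_succ, Nat.add_eq_zero_iff, Nat.add_eq_right, one_ne_zero, and_false,
    if_false, zero_mul, Finset.sum_const_zero, zero_add, Pi.add_apply, Pi.neg_apply]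
  simp [Matrix.mulVec, dotProduct, add_assoc]

/-- The matrix inequality read along solutions. On vectors `(a, z 0, …, z r)` in the kernel of `S`
the multiplier terms `X S` and `Sᵀ Xᵀ` vanish, so that `Γ` itself is negative definite there. -/
theorem exists_lmi_bound {n : ℕ} (A D : Matrix (Fin n) (Fin n) ℝ) (r : ℕ) (hr : 1 ≤ r) (hm : ℝ)
    {P R : Matrix (Fin n) (Fin n) ℝ} {Q : Matrix (Fin r × Fin n) (Fin r × Fin n) ℝ}
    (hP : P.PosDef) (hR : R.PosDef) (X : Matrix (BlockIdx r n) (Fin n) ℝ)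
    (hLMI : (-(Gam r hm P R Q + X * rowS r A D + (rowS r A D)ᵀ * Xᵀ)).PosDef) :
    ∃ c > 0, ∀ (a : Fin n → ℝ) (z : ℕ → Fin n → ℝ), a = A *ᵥ z 0 + D *ᵥ z r →
      hm / r * (a ⬝ᵥ R *ᵥ a) + 2 * (z 0 ⬝ᵥ P *ᵥ a)
        - r / hm * ((z 0 - z 1) ⬝ᵥ R *ᵥ (z 0 - z 1))
        + window r z ⬝ᵥ Q *ᵥ window r z
        - window r (fun k => z (k + 1)) ⬝ᵥ Q *ᵥ window r (fun k => z (k + 1))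
      ≤ -(c * (z 0 ⬝ᵥ z 0 + a ⬝ᵥ a)) := by
  obtain ⟨c, hc, hle⟩ := exists_le_quadForm hLMI
  refine ⟨c, hc, fun a z haz => ?_⟩
  have hker : rowS r A D *ᵥ stack r a z = 0 := by
    rw [rowS_mulVec_stack r hr, haz]
    abel
  have hX1 : stack r a z ⬝ᵥ (X * rowS r A D) *ᵥ stack r a z = 0 := by
    rw [← Matrix.mulVec_mulVec, hker]
    simp
  have hX2 : stack r a z ⬝ᵥ ((rowS r A D)ᵀ * Xᵀ) *ᵥ stack r a z = 0 := by
    rw [← Matrix.mulVec_mulVec, Matrix.dotProduct_mulVec, Matrix.vecMul_transpose, hker]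
    simp
  have hQ1 := quadForm_embedQ r 1 (by omega) Q (stack r a z) (window r z) fun _ => rfl
  have hQ2 := quadForm_embedQ r 2 (by omega) Q (stack r a z) (window r fun k => z (k + 1))
    fun _ => rfl
  have hPR := quadForm_gammaPR r hr hm hP hR a z
  have hself : z 0 ⬝ᵥ z 0 + a ⬝ᵥ a ≤ stack r a z ⬝ᵥ stack r a z := by
    have : stack r a z ⬝ᵥ stack r a z = a ⬝ᵥ a + (z 0 ⬝ᵥ z 0
        + ∑ k : Fin r, z (k + 1) ⬝ᵥ z (k + 1)) := by
      simp only [dotProduct, stack, Fintype.sum_prod_type, Fin.sum_univ_succ]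
      simp
    rw [this]
    have := Finset.sum_nonneg fun (k : Fin r) (_ : k ∈ Finset.univ) =>
      dotProduct_self_nonneg (z (k + 1))
    linarith
  have hmain := hle (stack r a z)
  rw [Gam] at hmain
  simp only [Matrix.neg_mulVec, Matrix.add_mulVec, Matrix.sub_mulVec, dotProduct_neg,
    dotProduct_add, dotProduct_sub, hX1, hX2, hQ1, hQ2, hPR] at hmain
  have := mul_le_mul_of_nonneg_left hself hc.le
  linarith

/-! ### Integrals over sliding windows -/

/-- The integral of `w` over the window of length `τ` that ends at `t`. -/
noncomputable def slide (w : ℝ → ℝ) (τ t : ℝ) : ℝ := ∫ s in (t - τ)..t, w s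

/-- The integral of `w` over the window of length `τ` that ends at `t`, with a weight growing
linearly from `0` to `τ`. It equals the double integral `∫ v in (t - τ)..t, ∫ s in v..t, w s`. -/
noncomputable def ramp (w : ℝ → ℝ) (τ t : ℝ) : ℝ := ∫ s in (t - τ)..t, (s - (t - τ)) * w s

theorem hasDerivAt_slide {w : ℝ → ℝ} (hw : Continuous w) (τ t : ℝ) :
    HasDerivAt (slide w τ) (w t - w (t - τ)) t := by
  have heq : slide w τ = fun t => (∫ s in (0 : ℝ)..t, w s) - ∫ s in (0 : ℝ)..(t - τ), w s := by
    funext t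
    exact (intervalIntegral.integral_interval_sub_left (hw.intervalIntegrable _ _)
      (hw.intervalIntegrable _ _)).symm
  rw [heq]
  have h1 : ∀ b, HasDerivAt (fun t => ∫ s in (0 : ℝ)..t, w s) (w b) b := fun b =>
    (hw.integral_hasStrictDerivAt 0 b).hasDerivAt
  exact (h1 t).fun_sub ((h1 (t - τ)).comp_sub_const t τ)

theorem hasDerivAt_ramp {w : ℝ → ℝ} (hw : Continuous w) (τ t : ℝ) :
    HasDerivAt (ramp w τ) (τ * w t - slide w τ t) t := by
  have hsw : Continuous fun s => s * w s := by fun_prop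
  have heq : ramp w τ = fun t => slide (fun s => s * w s) τ t - (t - τ) * slide w τ t := by
    funext t
    simp only [ramp, slide, sub_mul]
    rw [intervalIntegral.integral_sub (hsw.intervalIntegrable _ _)
      ((Continuous.intervalIntegrable (by fun_prop) _ _)),
      intervalIntegral.integral_sub ((Continuous.intervalIntegrable (by fun_prop) _ _))
      ((Continuous.intervalIntegrable (by fun_prop) _ _)),
      intervalIntegral.integral_const_mul, intervalIntegral.integral_const_mul]
  rw [heq]
  have h1 := (hasDerivAt_slide hsw τ t).fun_sub
    (((hasDerivAt_id t).sub_const τ).mul (hasDerivAt_slide hw τ t))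
  refine h1.congr_deriv ?_
  simp only [id]
  ring

theorem slide_mono {v w : ℝ → ℝ} (hv : Continuous v) (hw : Continuous w) {τ t : ℝ} (hτ : 0 ≤ τ)
    (h : ∀ s ∈ Icc (t - τ) t, v s ≤ w s) : slide v τ t ≤ slide w τ t :=
  intervalIntegral.integral_mono_on (by linarith) (hv.intervalIntegrable _ _)
    (hw.intervalIntegrable _ _) h

theorem slide_const_mul (c : ℝ) (w : ℝ → ℝ) (τ t : ℝ) :
    slide (fun s => c * w s) τ t = c * slide w τ t :=
  intervalIntegral.integral_const_mul _ _

theorem slide_le_of_le {w : ℝ → ℝ} (hw : Continuous w) {τ t E : ℝ} (hτ : 0 ≤ τ)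
    (h : ∀ s ∈ Icc (t - τ) t, w s ≤ E) : slide w τ t ≤ τ * E := by
  refine (slide_mono hw continuous_const hτ h).trans (le_of_eq ?_)
  simp [slide]

theorem slide_nonneg {w : ℝ → ℝ} {τ : ℝ} (hτ : 0 ≤ τ) (h : ∀ s, 0 ≤ w s) (t : ℝ) :
    0 ≤ slide w τ t :=
  intervalIntegral.integral_nonneg (by linarith) fun s _ => h s

theorem ramp_nonneg {w : ℝ → ℝ} {τ : ℝ} (hτ : 0 ≤ τ) (h : ∀ s, 0 ≤ w s) (t : ℝ) :
    0 ≤ ramp w τ t :=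
  intervalIntegral.integral_nonneg (by linarith) fun s hs =>
    mul_nonneg (by linarith [hs.1]) (h s)

theorem ramp_le {w : ℝ → ℝ} (hw : Continuous w) {τ : ℝ} (hτ : 0 ≤ τ) (h : ∀ s, 0 ≤ w s) (t : ℝ) :
    ramp w τ t ≤ τ * slide w τ t := by
  rw [← slide_const_mul]
  refine intervalIntegral.integral_mono_on (by linarith)
    (Continuous.intervalIntegrable (by fun_prop) _ _)
    (Continuous.intervalIntegrable (by fun_prop) _ _) fun s hs => ?_
  exact mul_le_mul_of_nonneg_right (by linarith [hs.2]) (h s)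

/-- The `r` shifted windows of length `τ` tile the window of length `r τ`. -/
theorem slide_sum_shift {w : ℝ → ℝ} (hw : Continuous w) (τ t : ℝ) (r : ℕ) :
    slide (fun s => ∑ k ∈ Finset.range r, w (s - k * τ)) τ t = slide w (r * τ) t := by
  induction r with
  | zero => simp [slide]
  | succ r ih =>
    simp only [slide, Finset.sum_range_succ] at ih ⊢
    rw [intervalIntegral.integral_add (Continuous.intervalIntegrable (by fun_prop) _ _)
      (Continuous.intervalIntegrable (by fun_prop) _ _), ih,
      intervalIntegral.integral_comp_sub_right, add_comm,
      show t - τ - r * τ = t - (r + 1 : ℕ) * τ by push_cast; ring]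
    exact intervalIntegral.integral_add_adjacent_intervals (hw.intervalIntegrable _ _)
      (hw.intervalIntegrable _ _)

theorem slide_le_slide {w : ℝ → ℝ} (hw : Continuous w) (h : ∀ s, 0 ≤ w s) {τ τ' : ℝ}
    (hτ : τ ≤ τ') (t : ℝ) : slide w τ t ≤ slide w τ' t := by
  have hadd : (∫ s in (t - τ')..(t - τ), w s) + slide w τ t = slide w τ' t :=
    intervalIntegral.integral_add_adjacent_intervals (hw.intervalIntegrable _ _)
      (hw.intervalIntegrable _ _)
  have := intervalIntegral.integral_nonneg (μ := MeasureTheory.volume)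
    (show t - τ' ≤ t - τ by linarith) fun s _ => h s
  linarith

/-! ### Differential inequalities and derivatives of quadratic forms -/

/-- Grönwall's inequality for a constant rate `k` of either sign. -/
theorem le_mul_exp_of_hasDerivAt {U U' : ℝ → ℝ} {a k : ℝ} (hc : ContinuousOn U (Ici a))
    (hd : ∀ t, a < t → HasDerivAt U (U' t) t) (hle : ∀ t, a < t → U' t ≤ k * U t) {t : ℝ}
    (ht : a ≤ t) : U t ≤ U a * Real.exp (k * (t - a)) := by
  have hder : ∀ t, a < t → HasDerivAt (fun t => U t * Real.exp (-(k * (t - a))))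
      (U' t * Real.exp (-(k * (t - a))) + U t * (Real.exp (-(k * (t - a))) * -(k * 1))) t :=
    fun t ht => (hd t ht).fun_mul ((((hasDerivAt_id t).sub_const a).const_mul k).fun_neg.exp)
  have hanti : AntitoneOn (fun t => U t * Real.exp (-(k * (t - a)))) (Ici a) := by
    refine antitoneOn_of_deriv_nonpos (convex_Ici a) (by fun_prop) ?_ ?_
    · rw [interior_Ici]
      exact fun t ht => (hder t ht).differentiableAt.differentiableWithinAt
    · rw [interior_Ici]
      intro t ht
      rw [(hder t ht).deriv]
      have := mul_le_mul_of_nonneg_right (hle t ht) (Real.exp_pos (-(k * (t - a)))).le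
      linarith
  have h := hanti self_mem_Ici ht ht
  simp only [sub_self, mul_zero, neg_zero, Real.exp_zero, mul_one] at h
  rwa [Real.exp_neg, ← div_eq_mul_inv, div_le_iff₀ (Real.exp_pos _)] at h

theorem hasDerivAt_dotProduct {ι : Type*} [Fintype ι] {u v : ℝ → ι → ℝ} {u' v' : ι → ℝ} {t : ℝ}
    (hu : HasDerivAt u u' t) (hv : HasDerivAt v v' t) :
    HasDerivAt (fun s => u s ⬝ᵥ v s) (u' ⬝ᵥ v t + u t ⬝ᵥ v') t := by
  have h := HasDerivAt.fun_sum (u := Finset.univ) fun i _ =>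
    (hasDerivAt_pi.1 hu i).fun_mul (hasDerivAt_pi.1 hv i)
  refine h.congr_deriv ?_
  simp only [dotProduct, Finset.sum_add_distrib]

theorem hasDerivAt_mulVec {ι κ : Type*} [Fintype ι] [Fintype κ] (M : Matrix κ ι ℝ)
    {u : ℝ → ι → ℝ} {u' : ι → ℝ} {t : ℝ} (hu : HasDerivAt u u' t) :
    HasDerivAt (fun s => M *ᵥ u s) (M *ᵥ u') t :=
  hasDerivAt_pi.2 fun i => by
    simpa [Matrix.mulVec] using hasDerivAt_dotProduct (hasDerivAt_const t (M i)) hu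

theorem hasDerivAt_quadForm {ι : Type*} [Fintype ι] {M : Matrix ι ι ℝ} (hM : M.PosDef)
    {u : ℝ → ι → ℝ} {u' : ι → ℝ} {t : ℝ} (hu : HasDerivAt u u' t) :
    HasDerivAt (fun s => u s ⬝ᵥ M *ᵥ u s) (2 * (u t ⬝ᵥ M *ᵥ u')) t := by
  refine (hasDerivAt_dotProduct hu (hasDerivAt_mulVec M hu)).congr_deriv ?_
  rw [quadForm_comm hM u']
  ring

/-- A form of Jensen's inequality without division by the length `τ` of the window, valid also
for `τ = 0`. The function `s ↦ ∫ (f - v)ᵀ R (f - v)` is monotone for every constant vector `v`;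
the vector `v = κ (y t - y (t - τ))` gives the claim. -/
theorem jensen_slide {ι : Type*} [Fintype ι] {R : Matrix ι ι ℝ} (hR : R.PosDef)
    {y f : ℝ → ι → ℝ} (hy : Continuous y) (hf : Continuous f) {τ κ t : ℝ} (hτ : 0 ≤ τ)
    (hκ : 0 ≤ κ) (hτκ : τ * κ ≤ 1) (hd : ∀ s, t - τ < s → HasDerivAt y (f s) s) :
    κ * ((y t - y (t - τ)) ⬝ᵥ R *ᵥ (y t - y (t - τ))) ≤ slide (fun s => f s ⬝ᵥ R *ᵥ f s) τ t := by
  set g : ℝ → ℝ := fun s => f s ⬝ᵥ R *ᵥ f s with hg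
  have hgc : Continuous g := by fun_prop
  set v : ι → ℝ := κ • (y t - y (t - τ)) with hv
  have hder : ∀ s, t - τ < s →
      HasDerivAt (fun s => (∫ σ in (t - τ)..s, g σ) - 2 * (v ⬝ᵥ R *ᵥ y s) + s * (v ⬝ᵥ R *ᵥ v))
        (g s - 2 * (v ⬝ᵥ R *ᵥ f s) + 1 * (v ⬝ᵥ R *ᵥ v)) s := by
    intro s hs
    have h1 := (hgc.integral_hasStrictDerivAt (t - τ) s).hasDerivAt
    have h2 := hasDerivAt_dotProduct (hasDerivAt_const s v) (hasDerivAt_mulVec R (hd s hs))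
    rw [zero_dotProduct, zero_add] at h2
    exact (h1.fun_sub (h2.const_mul 2)).fun_add ((hasDerivAt_id s).mul_const _)
  have hcont : Continuous fun s =>
      (∫ σ in (t - τ)..s, g σ) - 2 * (v ⬝ᵥ R *ᵥ y s) + s * (v ⬝ᵥ R *ᵥ v) := by
    have : Continuous fun s => ∫ σ in (t - τ)..s, g σ :=
      intervalIntegral.continuous_primitive (fun a b => hgc.intervalIntegrable a b) _
    fun_prop
  have hmono : MonotoneOn (fun s =>
      (∫ σ in (t - τ)..s, g σ) - 2 * (v ⬝ᵥ R *ᵥ y s) + s * (v ⬝ᵥ R *ᵥ v)) (Ici (t - τ)) := by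
    refine monotoneOn_of_deriv_nonneg (convex_Ici _) hcont.continuousOn ?_ ?_
    · rw [interior_Ici]
      exact fun s hs => (hder s hs).differentiableAt.differentiableWithinAt
    · rw [interior_Ici]
      intro s hs
      rw [(hder s hs).deriv]
      have := quadForm_nonneg hR (f s - v)
      simp only [Matrix.mulVec_sub, dotProduct_sub, sub_dotProduct, quadForm_comm hR (f s) v]
        at this
      simp only [hg]
      linarith
  have h := hmono self_mem_Ici (show t - τ ≤ t by linarith) (by linarith)
  have hΔ := quadForm_nonneg hR (y t - y (t - τ))
  have e1 : v ⬝ᵥ R *ᵥ v = κ ^ 2 * ((y t - y (t - τ)) ⬝ᵥ R *ᵥ (y t - y (t - τ))) := by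
    simp only [hv, Matrix.mulVec_smul, smul_dotProduct, dotProduct_smul, smul_eq_mul]
    ring
  have e2 : v ⬝ᵥ R *ᵥ y t - v ⬝ᵥ R *ᵥ y (t - τ)
      = κ * ((y t - y (t - τ)) ⬝ᵥ R *ᵥ (y t - y (t - τ))) := by
    rw [← dotProduct_sub, ← Matrix.mulVec_sub, hv, smul_dotProduct, smul_eq_mul]
  simp only [intervalIntegral.integral_same, e1] at h
  change κ * _ ≤ ∫ σ in (t - τ)..t, g σ
  nlinarith [mul_nonneg (mul_nonneg hκ hΔ) (sub_nonneg.2 hτκ)]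

/-! ### Exponential bounds for the delay equation -/

theorem window_dotProduct_self {n : ℕ} (r : ℕ) (z : ℕ → Fin n → ℝ) :
    window r z ⬝ᵥ window r z = ∑ k ∈ Finset.range r, z k ⬝ᵥ z k := by
  simp only [dotProduct, window, Fintype.sum_prod_type, Finset.sum_range]

/-- Solutions of `y'(t) = A y(t) + D y(t - h)` grow at most exponentially: the functional
`y(t)ᵀ y(t) + ∫ s in (t - h)..t, y(s)ᵀ y(s)` does. -/
theorem exists_growth_bound {n : ℕ} (A D : Matrix (Fin n) (Fin n) ℝ) {h : ℝ} (hh : 0 ≤ h) :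
    ∃ L, 0 ≤ L ∧ ∀ y : ℝ → Fin n → ℝ, Continuous y →
      (∀ t, 0 < t → HasDerivAt y (A *ᵥ y t + D *ᵥ y (t - h)) t) → ∀ t, 0 ≤ t →
      y t ⬝ᵥ y t ≤ (y 0 ⬝ᵥ y 0 + slide (fun s => y s ⬝ᵥ y s) h 0) * Real.exp (L * t) := by
  obtain ⟨a, ha, hA⟩ := exists_quadForm_le A
  obtain ⟨d, hd, hD⟩ := exists_mulVec_dotProduct_le Dᵀ
  refine ⟨2 * a + d + 1, by positivity, fun y hy hder t ht => ?_⟩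
  have hyy : Continuous fun s => y s ⬝ᵥ y s := by fun_prop
  have hnn := slide_nonneg hh fun s => dotProduct_self_nonneg (y s)
  have hW : ∀ t, 0 < t → HasDerivAt (fun t => y t ⬝ᵥ y t + slide (fun s => y s ⬝ᵥ y s) h t)
      ((A *ᵥ y t + D *ᵥ y (t - h)) ⬝ᵥ y t + y t ⬝ᵥ (A *ᵥ y t + D *ᵥ y (t - h))
        + (y t ⬝ᵥ y t - y (t - h) ⬝ᵥ y (t - h))) t := fun t ht =>
    (hasDerivAt_dotProduct (hder t ht) (hder t ht)).fun_add (hasDerivAt_slide hyy h t)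
  have hcont : Continuous fun t => y t ⬝ᵥ y t + slide (fun s => y s ⬝ᵥ y s) h t :=
    hyy.add (continuous_iff_continuousAt.2 fun t => (hasDerivAt_slide hyy h t).continuousAt)
  have key := le_mul_exp_of_hasDerivAt (k := 2 * a + d + 1) hcont.continuousOn hW ?_ ht
  · rw [sub_zero] at key
    linarith [hnn t]
  · intro t _
    have h1 := hA (y t)
    have h2 := hD (y t)
    have h3 := two_mul_dotProduct_le (Dᵀ *ᵥ y t) (y (t - h))
    have h4 : Dᵀ *ᵥ y t ⬝ᵥ y (t - h) = y t ⬝ᵥ D *ᵥ y (t - h) := by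
      rw [Matrix.dotProduct_mulVec, Matrix.mulVec_transpose]
    rw [h4] at h3
    rw [dotProduct_comm _ (y t), dotProduct_add]
    have h5 := mul_nonneg (by positivity : 0 ≤ 2 * a + d + 1) (hnn t)
    linarith

/-- Exponential decay from time `h` on. The matrix inequality makes the Lyapunov–Krasovskii
functional decrease at a rate that controls the functional itself. -/
theorem exists_lyapunov_decay {n : ℕ} (A D : Matrix (Fin n) (Fin n) ℝ) (r : ℕ) (hr : 1 ≤ r)
    {hm : ℝ} {P R : Matrix (Fin n) (Fin n) ℝ} {Q : Matrix (Fin r × Fin n) (Fin r × Fin n) ℝ}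
    (hP : P.PosDef) (hR : R.PosDef) (hQ : Q.PosDef) (X : Matrix (BlockIdx r n) (Fin n) ℝ)
    (hLMI : (-(Gam r hm P R Q + X * rowS r A D + (rowS r A D)ᵀ * Xᵀ)).PosDef)
    {h : ℝ} (hh : 0 ≤ h) (hle : h ≤ hm) (hhm : 0 < hm) :
    ∃ C, 0 ≤ C ∧ ∃ μ > 0, ∀ y f : ℝ → Fin n → ℝ, Continuous y →
      (∀ t, f t = A *ᵥ y t + D *ᵥ y (t - h)) → (∀ t, 0 < t → HasDerivAt y (f t) t) →
      ∀ t, h ≤ t → y t ⬝ᵥ y t ≤ C * (y h ⬝ᵥ y h + f h ⬝ᵥ f h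
        + slide (fun s => y s ⬝ᵥ y s + f s ⬝ᵥ f s) h h) * Real.exp (-μ * (t - h)) := by
  obtain ⟨c, hc, hlmi⟩ := exists_lmi_bound A D r hr hm hP hR X hLMI
  obtain ⟨p, hp, hPlow⟩ := exists_le_quadForm hP
  obtain ⟨CP, hCP, hPup⟩ := exists_quadForm_le P
  obtain ⟨CR, hCR, hRup⟩ := exists_quadForm_le R
  obtain ⟨CQ, hCQ, hQup⟩ := exists_quadForm_le Q
  have hr0 : (0 : ℝ) < r := by exact_mod_cast hr
  obtain ⟨τ, hτ⟩ : ∃ τ, τ = h / r := ⟨_, rfl⟩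
  have hτ0 : 0 ≤ τ := by rw [hτ]; positivity
  have hrτ : r * τ = h := by rw [hτ]; field_simp
  have hτh : τ ≤ h := by
    rw [hτ]
    exact div_le_self hh (by exact_mod_cast hr)
  have hτm : τ ≤ hm / r := by rw [hτ]; gcongr
  -- The weight of the extra term `ramp w h` of the functional: so small that `ε h w` is
  -- absorbed by the decrease `-c w`, which leaves `-ε (w + ∫ w)`.
  obtain ⟨ε, hε⟩ : ∃ ε, ε = c / (h + 1) := ⟨_, rfl⟩
  have hε0 : 0 < ε := by rw [hε]; positivity
  have hεc : ε * h + ε ≤ c := by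
    have : ε * (h + 1) = c := by rw [hε]; field_simp
    linarith
  set K : ℝ := CP + τ * CR + CQ + ε * h + 1 with hK
  have hK0 : 0 < K := by positivity
  refine ⟨K / p, by positivity, ε / K, by positivity, fun y f hy hf hder t ht => ?_⟩
  have hfc : Continuous f := by
    rw [show f = fun t => A *ᵥ y t + D *ᵥ y (t - h) from funext hf]
    fun_prop
  set w : ℝ → ℝ := fun s => y s ⬝ᵥ y s + f s ⬝ᵥ f s with hw
  have hyw : ∀ s, y s ⬝ᵥ y s ≤ w s := fun s => le_add_of_nonneg_right (dotProduct_self_nonneg _)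
  have hfw : ∀ s, f s ⬝ᵥ f s ≤ w s := fun s => le_add_of_nonneg_left (dotProduct_self_nonneg _)
  have hw0 : ∀ s, 0 ≤ w s := fun s => (dotProduct_self_nonneg _).trans (hyw s)
  have hwc : Continuous w := by fun_prop
  set g : ℝ → ℝ := fun s => f s ⬝ᵥ R *ᵥ f s with hg
  have hgc : Continuous g := by fun_prop
  have hg0 : ∀ s, 0 ≤ g s := fun s => quadForm_nonneg hR _
  set ζ : ℝ → Fin r × Fin n → ℝ := fun s => window r fun k => y (s - k * τ) with hζ
  have hζc : Continuous ζ := continuous_pi fun i => by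
    simp only [hζ, window]
    fun_prop
  set q : ℝ → ℝ := fun s => ζ s ⬝ᵥ Q *ᵥ ζ s with hq
  have hqc : Continuous q := by fun_prop
  have hq0 : ∀ s, 0 ≤ q s := fun s => quadForm_nonneg hQ _
  have hI0 : ∀ t, 0 ≤ slide w h t := slide_nonneg hh hw0
  set V : ℝ → ℝ := fun t => y t ⬝ᵥ P *ᵥ y t + ramp g τ t + slide q τ t + ε * ramp w h t with hV
  have hVlow : ∀ t, p * (y t ⬝ᵥ y t) ≤ V t := by
    intro t
    have h1 := hPlow (y t)
    have h2 := ramp_nonneg hτ0 hg0 t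
    have h3 := slide_nonneg hτ0 hq0 t
    have h4 := mul_nonneg hε0.le (ramp_nonneg hh hw0 t)
    simp only [hV]
    linarith
  have hVup : ∀ t, V t ≤ K * (w t + slide w h t) := by
    intro t
    have h1 : y t ⬝ᵥ P *ᵥ y t ≤ CP * w t := (hPup (y t)).trans (by gcongr; exact hyw t)
    have h2 : ramp g τ t ≤ τ * CR * slide w h t := by
      calc ramp g τ t ≤ τ * slide g τ t := ramp_le hgc hτ0 hg0 t
        _ ≤ τ * slide (fun s => CR * w s) τ t := by
          refine mul_le_mul_of_nonneg_left (slide_mono hgc (by fun_prop) hτ0 fun s _ => ?_) hτ0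
          exact (hRup (f s)).trans (by gcongr; exact hfw s)
        _ = τ * CR * slide w τ t := by rw [slide_const_mul, mul_assoc]
        _ ≤ τ * CR * slide w h t := by
          gcongr
          exact slide_le_slide hwc hw0 hτh t
    have h3 : slide q τ t ≤ CQ * slide w h t := by
      calc slide q τ t
          ≤ slide (fun s => CQ * ∑ k ∈ Finset.range r, w (s - k * τ)) τ t := by
            refine slide_mono hqc (by fun_prop) hτ0 fun s _ => (hQup (ζ s)).trans ?_
            rw [hζ, window_dotProduct_self]
            gcongr
            exact hyw _
        _ = CQ * slide w h t := by rw [slide_const_mul, slide_sum_shift hwc, hrτ]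
    have h4 : ε * ramp w h t ≤ ε * (h * slide w h t) := by
      gcongr
      exact ramp_le hwc hh hw0 t
    have e1 : 0 ≤ (τ * CR + CQ + ε * h + 1) * w t := mul_nonneg (by positivity) (hw0 t)
    have e2 : 0 ≤ (CP + 1) * slide w h t := mul_nonneg (by positivity) (hI0 t)
    simp only [hV, hK]
    linarith
  have hVder : ∀ t, 0 < t → HasDerivAt V (2 * (y t ⬝ᵥ P *ᵥ f t) + (τ * g t - slide g τ t)
      + (q t - q (t - τ)) + ε * (h * w t - slide w h t)) t := fun t ht =>
    (((hasDerivAt_quadForm hP (hder t ht)).fun_add (hasDerivAt_ramp hgc τ t)).fun_add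
      (hasDerivAt_slide hqc τ t)).fun_add ((hasDerivAt_ramp hwc h t).const_mul ε)
  have hVcont : Continuous V := by
    have c1 : Continuous (ramp g τ) :=
      continuous_iff_continuousAt.2 fun t => (hasDerivAt_ramp hgc τ t).continuousAt
    have c2 : Continuous (slide q τ) :=
      continuous_iff_continuousAt.2 fun t => (hasDerivAt_slide hqc τ t).continuousAt
    have c3 : Continuous (ramp w h) :=
      continuous_iff_continuousAt.2 fun t => (hasDerivAt_ramp hwc h t).continuousAt
    fun_prop
  have hdecr : ∀ t, h < t → 2 * (y t ⬝ᵥ P *ᵥ f t) + (τ * g t - slide g τ t)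
      + (q t - q (t - τ)) + ε * (h * w t - slide w h t) ≤ -(ε / K) * V t := by
    intro t ht
    have hJ := jensen_slide hR hy hfc (t := t) hτ0 (show 0 ≤ r / hm by positivity)
      (by calc τ * (r / hm) ≤ hm / r * (r / hm) := by gcongr
            _ = 1 := by field_simp)
      fun s hs => hder s (by linarith)
    have hL := hlmi (f t) (fun k => y (t - k * τ)) (by simp [hrτ, hf])
    have hshift : (fun k : ℕ => y (t - (k + 1 : ℕ) * τ)) = fun k : ℕ => y (t - τ - k * τ) := by
      funext k
      congr 1
      push_cast
      ring
    rw [hshift] at hL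
    simp only [Nat.cast_zero, zero_mul, sub_zero, Nat.cast_one, one_mul] at hL
    have hτg : τ * g t ≤ hm / r * g t := by
      gcongr
      exact hg0 t
    have hε1 : (ε * h + ε) * w t ≤ c * w t := by
      gcongr
      exact hw0 t
    have hVK : ε / K * V t ≤ ε * (w t + slide w h t) := by
      calc ε / K * V t ≤ ε / K * (K * (w t + slide w h t)) := by
            gcongr
            exact hVup t
        _ = ε * (w t + slide w h t) := by field_simp
    change hm / r * g t + _ - _ + q t - q (t - τ) ≤ -(c * w t) at hL
    change _ ≤ slide g τ t at hJ
    linarith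
  have hfin := le_mul_exp_of_hasDerivAt hVcont.continuousOn
    (fun t ht => hVder t (hh.trans_lt ht)) hdecr ht
  have hexp := (Real.exp_pos (-(ε / K) * (t - h))).le
  have h1 := (hVlow t).trans (hfin.trans (mul_le_mul_of_nonneg_right (hVup h) hexp))
  calc y t ⬝ᵥ y t = p * (y t ⬝ᵥ y t) / p := by field_simp
    _ ≤ K * (w h + slide w h h) * Real.exp (-(ε / K) * (t - h)) / p := by gcongr
    _ = _ := by ring

/-- Exponential stability of `y'(t) = A y(t) + D y(t - h)` in terms of the supremum of the
initial condition: the growth bound covers `[0, h]`, and the Lyapunov–Krasovskii functional the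
times after `h`. -/
theorem exists_exponential_bound {n : ℕ} (A D : Matrix (Fin n) (Fin n) ℝ) (r : ℕ) (hr : 1 ≤ r)
    {hm : ℝ} {P R : Matrix (Fin n) (Fin n) ℝ} {Q : Matrix (Fin r × Fin n) (Fin r × Fin n) ℝ}
    (hP : P.PosDef) (hR : R.PosDef) (hQ : Q.PosDef) (X : Matrix (BlockIdx r n) (Fin n) ℝ)
    (hLMI : (-(Gam r hm P R Q + X * rowS r A D + (rowS r A D)ᵀ * Xᵀ)).PosDef)
    {h : ℝ} (hh : 0 ≤ h) (hle : h ≤ hm) (hhm : 0 < hm) :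
    ∃ C, 0 ≤ C ∧ ∃ μ > 0, ∀ y : ℝ → Fin n → ℝ, Continuous y →
      (∀ t, 0 < t → HasDerivAt y (A *ᵥ y t + D *ᵥ y (t - h)) t) →
      ∀ M, (∀ s, s ≤ 0 → ‖y s‖ ≤ M) →
      ∀ t, 0 ≤ t → ‖y t‖ ^ 2 ≤ C * M ^ 2 * Real.exp (-μ * t) := by
  obtain ⟨L, hL, hgrow⟩ := exists_growth_bound A D hh
  obtain ⟨C, hC, μ, hμ, hdecay⟩ := exists_lyapunov_decay A D r hr hP hR hQ X hLMI hh hle hhm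
  obtain ⟨a, ha, hA⟩ := exists_mulVec_dotProduct_le A
  obtain ⟨d, hd, hD⟩ := exists_mulVec_dotProduct_le D
  set G : ℝ := (1 + h) * n * Real.exp (L * h) with hG
  set F : ℝ := C * (1 + h) * (1 + 2 * (a + d)) with hF
  refine ⟨(1 + F) * G * Real.exp (μ * h), by positivity, μ, hμ, fun y hy hder M hM t ht => ?_⟩
  refine (norm_sq_le_dotProduct_self (y t)).trans ?_
  have hyy : Continuous fun s => y s ⬝ᵥ y s := by fun_prop
  have hpast : ∀ s, s ≤ 0 → y s ⬝ᵥ y s ≤ n * M ^ 2 := by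
    intro s hs
    refine (dotProduct_self_le_norm_sq (y s)).trans ?_
    rw [Fintype.card_fin]
    have := hM s hs
    gcongr
  have hexp1 : 1 ≤ Real.exp (L * h) := Real.one_le_exp (by positivity)
  have hE : ∀ s, s ≤ h → y s ⬝ᵥ y s ≤ G * M ^ 2 := by
    intro s hs
    have hbase : 0 ≤ n * M ^ 2 := by positivity
    rcases le_total s 0 with hs0 | hs0
    · have : 1 * (n * M ^ 2) ≤ (1 + h) * Real.exp (L * h) * (n * M ^ 2) := by
        gcongr
        nlinarith
      calc y s ⬝ᵥ y s ≤ 1 * (n * M ^ 2) := by rw [one_mul]; exact hpast s hs0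
        _ ≤ (1 + h) * Real.exp (L * h) * (n * M ^ 2) := this
        _ = G * M ^ 2 := by rw [hG]; ring
    · have h1 : slide (fun s => y s ⬝ᵥ y s) h 0 ≤ h * (n * M ^ 2) :=
        slide_le_of_le hyy hh fun s hs => hpast s hs.2
      calc y s ⬝ᵥ y s ≤ (y 0 ⬝ᵥ y 0 + slide (fun s => y s ⬝ᵥ y s) h 0) * Real.exp (L * s) :=
            hgrow y hy hder s hs0
        _ ≤ (n * M ^ 2 + h * (n * M ^ 2)) * Real.exp (L * h) := by
            gcongr
            exact hpast 0 le_rfl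
        _ = G * M ^ 2 := by rw [hG]; ring
  have hGM : 0 ≤ G * M ^ 2 := by positivity
  have hF0 : 0 ≤ F := by positivity
  have hexp : Real.exp (μ * h) * Real.exp (-μ * t) = Real.exp (-μ * (t - h)) := by
    rw [← Real.exp_add]
    congr 1
    ring
  rw [show (1 + F) * G * Real.exp (μ * h) * M ^ 2 * Real.exp (-μ * t)
    = (1 + F) * (G * M ^ 2) * (Real.exp (μ * h) * Real.exp (-μ * t)) by ring, hexp]
  rcases le_total t h with hth | hth
  · have : 1 ≤ Real.exp (-μ * (t - h)) := Real.one_le_exp (by nlinarith)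
    calc y t ⬝ᵥ y t ≤ 1 * (G * M ^ 2) * 1 := by rw [one_mul, mul_one]; exact hE t hth
      _ ≤ (1 + F) * (G * M ^ 2) * Real.exp (-μ * (t - h)) := by
        gcongr
        linarith
  · set f : ℝ → Fin n → ℝ := fun t => A *ᵥ y t + D *ᵥ y (t - h) with hf
    have hfc : Continuous f := by fun_prop
    have hw : ∀ s, s ≤ h → y s ⬝ᵥ y s + f s ⬝ᵥ f s ≤ (1 + 2 * (a + d)) * (G * M ^ 2) := by
      intro s hs
      have h1 := hE s hs
      have h2 := hE (s - h) (by linarith)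
      have h3 : A *ᵥ y s ⬝ᵥ A *ᵥ y s ≤ a * (G * M ^ 2) := (hA (y s)).trans (by gcongr)
      have h4 : D *ᵥ y (s - h) ⬝ᵥ D *ᵥ y (s - h) ≤ d * (G * M ^ 2) :=
        (hD (y (s - h))).trans (by gcongr)
      have h5 := two_mul_dotProduct_le (A *ᵥ y s) (D *ᵥ y (s - h))
      simp only [hf, add_dotProduct, dotProduct_add,
        dotProduct_comm (D *ᵥ y (s - h)) (A *ᵥ y s)]
      linarith
    have hs := slide_le_of_le (w := fun s => y s ⬝ᵥ y s + f s ⬝ᵥ f s) (t := h) (by fun_prop) hh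
      fun s hs => hw s hs.2
    calc y t ⬝ᵥ y t ≤ C * (y h ⬝ᵥ y h + f h ⬝ᵥ f h
          + slide (fun s => y s ⬝ᵥ y s + f s ⬝ᵥ f s) h h) * Real.exp (-μ * (t - h)) :=
          hdecay y f hy (fun _ => rfl) hder t hth
      _ ≤ C * ((1 + 2 * (a + d)) * (G * M ^ 2) + h * ((1 + 2 * (a + d)) * (G * M ^ 2)))
          * Real.exp (-μ * (t - h)) := by
          gcongr
          exact hw h le_rfl
      _ = (0 + F) * (G * M ^ 2) * Real.exp (-μ * (t - h)) := by rw [hF]; ring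
      _ ≤ (1 + F) * (G * M ^ 2) * Real.exp (-μ * (t - h)) := by
          gcongr
          exact zero_le_one

/-! ### Stability of the closed loop -/

/-- Uniform exponential bounds imply uniform asymptotic stability. -/
theorem isStable_of_exponential_bound {n : ℕ} {h : ℝ}
    {Sol : (ℝ → Fin n → ℝ) → (ℝ → Fin n → ℝ) → Prop} {C μ : ℝ} (hC : 0 ≤ C) (hμ : 0 < μ)
    (hbound : ∀ φ x, Sol φ x → ∀ M, (∀ θ ∈ Icc (-h) 0, ‖φ θ‖ ≤ M) →
      ∀ t, 0 ≤ t → ‖x t‖ ^ 2 ≤ C * M ^ 2 * Real.exp (-μ * t)) :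
    IsStable h Sol := by
  constructor
  · intro ε hε
    refine ⟨ε / (C + 1), by positivity, fun φ x hx hφ t ht => ?_⟩
    refine lt_of_pow_lt_pow_left₀ 2 hε.le ((hbound φ x hx _ hφ t ht).trans_lt ?_)
    have h1 : Real.exp (-μ * t) ≤ 1 := Real.exp_le_one_iff.2 (by nlinarith)
    calc C * (ε / (C + 1)) ^ 2 * Real.exp (-μ * t) ≤ C * (ε / (C + 1)) ^ 2 * 1 := by gcongr
      _ = C / (C + 1) ^ 2 * ε ^ 2 := by field_simp
      _ < 1 * ε ^ 2 := by
        gcongr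
        rw [div_lt_one (by positivity)]
        nlinarith
      _ = ε ^ 2 := one_mul _
  · intro ρ _ ε hε
    have hlim : Filter.Tendsto (fun t => C * ρ ^ 2 * Real.exp (-μ * t)) Filter.atTop (nhds 0) := by
      have h1 : Filter.Tendsto (fun t : ℝ => -μ * t) Filter.atTop Filter.atBot :=
        Filter.tendsto_id.const_mul_atTop_of_neg (by linarith)
      simpa using (Real.tendsto_exp_atBot.comp h1).const_mul (C * ρ ^ 2)
    obtain ⟨T, hT⟩ := Filter.eventually_atTop.1 (hlim.eventually (gt_mem_nhds (pow_pos hε 2)))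
    refine ⟨max T 1, by positivity, fun φ x hx hφ t ht => ?_⟩
    have ht0 : 0 ≤ t := zero_le_one.trans ((le_max_right _ _).trans ht)
    exact lt_of_pow_lt_pow_left₀ 2 hε.le
      ((hbound φ x hx _ hφ t ht0).trans_lt (hT t ((le_max_left _ _).trans ht)))

end TimeDelay

theorem proposition2 {n m p : ℕ} (A Ad : Matrix (Fin n) (Fin n) ℝ) (B : Matrix (Fin n) (Fin m) ℝ)
    (Bd : Matrix (Fin n) (Fin p) ℝ)
    (r : ℕ) (hr : 1 ≤ r) (hm : ℝ) (hhm : 0 < hm)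
    (P R : Matrix (Fin n) (Fin n) ℝ) (Q : Matrix (Fin r × Fin n) (Fin r × Fin n) ℝ)
    (hP : P.PosDef) (hR : R.PosDef) (hQ : Q.PosDef)
    (X : Matrix (TimeDelay.BlockIdx r n) (Fin n) ℝ) (K : Matrix (Fin m) (Fin n) ℝ)
    (hLMI : (-(TimeDelay.Gam r hm P R Q + X * TimeDelay.rowS r A (Ad + B * K)
      + (TimeDelay.rowS r A (Ad + B * K)).transpose * X.transpose)).PosDef) :
    ∀ h : ℝ, 0 ≤ h → h ≤ hm →
      TimeDelay.IsStable h (TimeDelay.IsClosedLoopSolution A Ad B Bd K h) := by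
  intro h hh hle
  obtain ⟨C, hC, μ, hμ, hbound⟩ := TimeDelay.exists_exponential_bound A (Ad + B * K) r hr hP hR hQ
    X hLMI hh hle hhm
  refine TimeDelay.isStable_of_exponential_bound hC hμ fun φ x ⟨hcont, hinit, hder⟩ M hM => ?_
  -- Extending the solution to the left of `-h` by a constant makes it continuous on `ℝ`.
  set y : ℝ → Fin n → ℝ := fun s => x (max s (-h)) with hy
  have hyx : ∀ s, -h ≤ s → y s = x s := fun s hs => by rw [hy]; simp only [max_eq_left hs]
  have hyc : Continuous y := hcont.comp_continuous (by fun_prop) fun s =>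
    mem_Ici.2 (le_max_right _ _)
  have hyder : ∀ t, 0 < t → HasDerivAt y (A.mulVec (y t) + (Ad + B * K).mulVec (y (t - h))) t := by
    intro t ht
    have h1 := (hder t ht.le).hasDerivAt (Ici_mem_nhds ht)
    rw [hyx t (by linarith), hyx (t - h) (by linarith)]
    refine (h1.congr_of_eventuallyEq ?_).congr_deriv ?_
    · filter_upwards [Ioi_mem_nhds ht] with s hs
      exact hyx s (by linarith [mem_Ioi.1 hs])
    · simp [Matrix.add_mulVec, Matrix.mulVec_mulVec, add_assoc]
  have hyM : ∀ s, s ≤ 0 → ‖y s‖ ≤ M := by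
    intro s hs
    have hmem : max s (-h) ∈ Icc (-h) 0 := ⟨le_max_right _ _, max_le hs (by linarith)⟩
    simp only [hy]
    rw [hinit _ hmem]
    exact hM _ hmem
  intro t ht
  have := hbound y hyc hyder M hyM t ht
  rwa [hyx t (by linarith)] at this
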